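/- Let $G$ be a finite simple graph with $n\ge 1$ vertices, and let $\lambda_1(G)\ge\lambda_2(G)\ge\dots\ge\lambda_n(G)$ be the eigenvalues (with multiplicity) of its adjacency matrix. The median eigenvalues of $G$ are $\lambda_h(G)$ and $\lambda_\ell(G)$, where $h=\lfloor\frac{n+1}{2}\rfloor$ and $\ell=\lceil\frac{n+1}{2}\rceil$, and the HL-index of $G$ is $R(G)=\max\{|\lambda_h(G)|,|\lambda_\ell(G)|\}$. The Heawood graph is the bipartite incidence graph of the points and lines of the Fano plane. Theorem. Let $G$ be a finite simple graph with at least one vertex that is bipartite and subcubic (that is, of maximum degree at most $3$). If every connected component of $G$ is isomorphic to the Heawood graph, then $R(G)=\lambda_h(G)=|\lambda_\ell(G)|=\sqrt2$. In any other case, both median eigenvalues $\lambda_h(G)$ and $\lambda_\ell(G)$ are contained in the interval $[-1,1]$, i.e., $R(G)\le 1$. -/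

import Mathlib

/-- The Heawood graph: the incidence graph of the points and lines of the Fano plane. The Fano plane
is given by its cyclic model: points (`Sum.inl`) and lines (`Sum.inr`) are indexed by `ZMod 7`, and
the line with index `j` consists of the three points `j`, `j + 1`, `j + 3`. -/
def heawoodGraph : SimpleGraph (ZMod 7 ⊕ ZMod 7) where
  Adj x y := match x, y with
    | Sum.inl p, Sum.inr j => p = j ∨ p = j + 1 ∨ p = j + 3
    | Sum.inr j, Sum.inl p => p = j ∨ p = j + 1 ∨ p = j + 3
    | _, _ => False
  symm := ⟨by rintro (p | j) (q | k) h <;> exact h⟩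
  loopless := ⟨by rintro (p | j) h <;> exact h⟩

section HLIndex

variable {V : Type*} [Fintype V] [DecidableEq V] (G : SimpleGraph V) [DecidableRel G.Adj]

/-- The `i`-th largest eigenvalue (`i = 1, …, n`, with multiplicity) of the real adjacency matrix of
a graph `G` on `n` vertices. (`eigenvalues₀` lists the eigenvalues in decreasing order, indexed from
`0`.) -/
noncomputable def SimpleGraph.adjEigenvalue (i : ℕ) (h1 : 1 ≤ i) (hn : i ≤ Fintype.card V) : ℝ :=
  (SimpleGraph.isHermitian_adjMatrix (R := ℝ) G).eigenvalues₀ ⟨i - 1, by omega⟩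

/-- The median eigenvalue `λ_h`, where `h = ⌊(n + 1) / 2⌋`. -/
noncomputable def SimpleGraph.medianH [Nonempty V] : ℝ :=
  G.adjEigenvalue ((Fintype.card V + 1) / 2)
    (by have := Fintype.card_pos (α := V); omega)
    (by have := Fintype.card_pos (α := V); omega)

/-- The median eigenvalue `λ_ℓ`, where `ℓ = ⌈(n + 1) / 2⌉ = ⌊(n + 2) / 2⌋`. -/
noncomputable def SimpleGraph.medianL [Nonempty V] : ℝ :=
  G.adjEigenvalue ((Fintype.card V + 2) / 2)
    (by have := Fintype.card_pos (α := V); omega)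
    (by have := Fintype.card_pos (α := V); omega)

/-- The HL-index `R(G) = max {|λ_h(G)|, |λ_ℓ(G)|}`. -/
noncomputable def SimpleGraph.hlIndex [Nonempty V] : ℝ :=
  max |G.medianH| |G.medianL|

end HLIndex

/-
The spectrum of a bipartite graph is symmetric about `0`, so `λ_ℓ = -λ_h` and `λ_h` is the least
absolute value of an eigenvalue. Hence `λ_h > 1` makes `A² - 1` positive definite. Short test
vectors then show that `G` is cubic without four-cycles, so `A² - 1 = 2 + K`, where `K` is the
adjacency matrix of the 6-regular graph of pairs of vertices with a common neighbour. This is the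
Gram matrix of an integral lattice, and all its row sums are `8`.

A claw or a diamond induced in `K` spans a sublattice of determinant `4` whose nonzero dual vectors
have norm at least `1`. Adjoining a vertex not orthogonal to the sublattice preserves the latter
property and does not increase the determinant. A sublattice that cannot be extended any more
consists of full rows of `2 + K`, so `8` divides its determinant, which is absurd. Thus `K` is
claw-free and diamond-free, which forces it to be a disjoint union of cliques: two points are always
on a line and two lines always meet. So every component of `G` is the incidence graph of a Fano
plane.

For the Heawood graph, `A² - 2` is the all-ones matrix on each colour class, so the eigenvalues
satisfy `μ² = 2` or `μ² = 9`. The value `λ_h = 3` is excluded because the diagonal of the positive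
semidefinite matrix `A² - λ_h²` is at most `3 - λ_h²`.
-/

section Spectral

open Matrix
open scoped ComplexOrder

theorem antitone_ext_of_map_univ {α : Type*} [LinearOrder α] {n : ℕ} {f g : Fin n → α}
    (hf : Antitone f) (hg : Antitone g)
    (h : Finset.univ.val.map f = Finset.univ.val.map g) : f = g := by
  rw [Fin.univ_val_map, Fin.univ_val_map, Multiset.coe_eq_coe] at h
  exact List.ofFn_injective
    (h.eq_of_pairwise' hf.sortedGE_ofFn.pairwise hg.sortedGE_ofFn.pairwise)

variable {n 𝕜 : Type*} [Fintype n] [DecidableEq n] [RCLike 𝕜] {A : Matrix n n 𝕜}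

theorem eigenvalues₀_eq_neg_rev (hA : A.IsHermitian) (h : A.charpoly = (-A).charpoly)
    (i : Fin (Fintype.card n)) : hA.eigenvalues₀ i = -hA.eigenvalues₀ i.rev := by
  have hroots : A.charpoly.roots =
      Finset.univ.val.map fun i => ((-hA.eigenvalues i : ℝ) : 𝕜) := by
    rw [h, ← cfc_neg_id (R := ℝ) A hA.isSelfAdjoint, hA.charpoly_cfc_eq, Polynomial.roots_prod _ _
      (Finset.prod_ne_zero_iff.2 fun i _ => Polynomial.X_sub_C_ne_zero _)]
    simp
  have hmap : Finset.univ.val.map hA.eigenvalues₀ =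
      Finset.univ.val.map fun i : Fin _ => -hA.eigenvalues₀ i.rev := by
    have hre := congrArg (Multiset.map RCLike.re)
      (hA.roots_charpoly_eq_eigenvalues₀.symm.trans hroots)
    simp only [Multiset.map_map, Function.comp_def, RCLike.ofReal_re] at hre
    rw [hre, ← Multiset.map_univ_val_equiv
      (Fin.revPerm.trans (Fintype.equivOfCardEq (Fintype.card_fin _))), Multiset.map_map]
    simp [IsHermitian.eigenvalues, Function.comp_def]
  have hanti := hA.eigenvalues₀_antitone
  exact congrFun (antitone_ext_of_map_univ hanti
    (fun _ _ hij => neg_le_neg (hanti (Fin.rev_le_rev.2 hij))) hmap) i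

theorem posDef_cfc (hA : A.IsHermitian) {f : ℝ → ℝ} (hf : ∀ i, 0 < f (hA.eigenvalues i)) :
    (cfc f A).PosDef := by
  rw [hA.cfc_eq, IsHermitian.cfc, Unitary.conjStarAlgAut_apply]
  exact (IsUnit.posDef_star_right_conjugate_iff
    (Unitary.toUnits hA.eigenvectorUnitary).isUnit).2
    (.diagonal fun i => RCLike.ofReal_pos.2 (hf i))

theorem posDef_sq_sub_smul_one (hA : A.IsHermitian) {c : ℝ} (h : ∀ i, c < hA.eigenvalues i ^ 2) :
    (A ^ 2 - c • (1 : Matrix n n 𝕜)).PosDef := by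
  have hsa : IsSelfAdjoint A := hA.isSelfAdjoint
  have hcfc : cfc (fun x : ℝ => x ^ 2 - c) A = A ^ 2 - c • (1 : Matrix n n 𝕜) := by
    rw [cfc_sub (fun x : ℝ => x ^ 2) (fun _ => c) A, cfc_pow_id A 2, cfc_const c A,
      Algebra.algebraMap_eq_smul_one]
  exact hcfc ▸ posDef_cfc hA fun i => sub_pos.2 (h i)

end Spectral

section Median

open SimpleGraph Matrix

variable {V : Type*} [Fintype V] [DecidableEq V] {G : SimpleGraph V} [DecidableRel G.Adj]

theorem charpoly_adjMatrix_eq_charpoly_neg {R : Type*} [CommRing R] (hbip : G.IsBipartite) :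
    (G.adjMatrix R).charpoly = (-G.adjMatrix R).charpoly := by
  obtain ⟨c⟩ := hbip
  let s : V → R := fun v => (-1) ^ (c v : ℕ)
  have hss : diagonal s * diagonal s = 1 := by
    simp [s, diagonal_mul_diagonal, ← mul_pow]
  have hconj : G.adjMatrix R = diagonal s * (-G.adjMatrix R) * diagonal s := by
    ext u v
    rw [mul_diagonal, diagonal_mul, neg_apply, adjMatrix_apply]
    split_ifs with h
    · have hne : c u ≠ c v := c.valid h
      obtain ⟨hu, hv⟩ | ⟨hu, hv⟩ : c u = 0 ∧ c v = 1 ∨ c u = 1 ∧ c v = 0 := by omega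
      all_goals simp [s, hu, hv]
    · simp
  conv_lhs => rw [hconj, charpoly_mul_comm, ← mul_assoc, hss, one_mul]

variable [Nonempty V]

theorem medianL_eq_neg_medianH (hbip : G.IsBipartite) : G.medianL = -G.medianH := by
  have hcard := Fintype.card_pos (α := V)
  refine (eigenvalues₀_eq_neg_rev (G.isHermitian_adjMatrix (R := ℝ))
    (charpoly_adjMatrix_eq_charpoly_neg hbip) _).trans ?_
  congr 2
  ext
  simp only [Fin.val_rev]
  omega

theorem medianL_le_medianH : G.medianL ≤ G.medianH :=
  (G.isHermitian_adjMatrix (R := ℝ)).eigenvalues₀_antitone (Fin.mk_le_mk.2 (by omega))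

theorem medianH_nonneg (hbip : G.IsBipartite) : 0 ≤ G.medianH := by
  linarith [medianL_eq_neg_medianH hbip, medianL_le_medianH (G := G)]

theorem hlIndex_eq_medianH (hbip : G.IsBipartite) : G.hlIndex = G.medianH := by
  rw [hlIndex, medianL_eq_neg_medianH hbip, abs_neg, max_self, abs_of_nonneg (medianH_nonneg hbip)]

theorem exists_eigenvalues_eq_medianH :
    ∃ i, (G.isHermitian_adjMatrix (R := ℝ)).eigenvalues i = G.medianH :=
  ⟨Fintype.equivOfCardEq (Fintype.card_fin _) ⟨(Fintype.card V + 1) / 2 - 1, by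
    have := Fintype.card_pos (α := V); omega⟩,
    by simp [IsHermitian.eigenvalues, medianH, adjEigenvalue]⟩

theorem medianH_le_abs_eigenvalues (hbip : G.IsBipartite) (i : V) :
    G.medianH ≤ |(G.isHermitian_adjMatrix (R := ℝ)).eigenvalues i| := by
  have hcard := Fintype.card_pos (α := V)
  have hanti := (G.isHermitian_adjMatrix (R := ℝ)).eigenvalues₀_antitone
  unfold IsHermitian.eigenvalues
  generalize (Fintype.equivOfCardEq (Fintype.card_fin _)).symm i = j
  rcases le_or_gt (j : ℕ) ((Fintype.card V + 1) / 2 - 1) with hj | hj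
  · exact (hanti (Fin.le_def.2 hj)).trans (le_abs_self _)
  · have hle : _ ≤ G.medianL := hanti (b := j) (Fin.le_def.2 (by dsimp only; omega))
    rw [medianL_eq_neg_medianH hbip] at hle
    exact (le_neg_of_le_neg hle).trans (neg_le_abs _)

theorem posDef_adjMatrix_sq_sub_of_lt_medianH (hbip : G.IsBipartite) {c : ℝ} (hc : 0 ≤ c)
    (h : c < G.medianH) : (G.adjMatrix ℝ ^ 2 - c ^ 2 • (1 : Matrix V V ℝ)).PosDef :=
  posDef_sq_sub_smul_one (G.isHermitian_adjMatrix (R := ℝ)) fun i =>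
    sq_lt_sq.2 ((abs_of_nonneg hc).trans_lt (h.trans_le (medianH_le_abs_eigenvalues hbip i)))

end Median

section Covering

open SimpleGraph Matrix

variable {V W : Type*} {G : SimpleGraph V} {H : SimpleGraph W} {φ : W → V}

/-- A covering of graphs: a map sending the neighbours of each vertex `w` bijectively onto the
neighbours of `φ w`. It need not be surjective. -/
def IsGraphCovering (H : SimpleGraph W) (G : SimpleGraph V) (φ : W → V) : Prop :=
  ∀ w, Set.BijOn φ (H.neighborSet w) (G.neighborSet (φ w))

theorem isGraphCovering_of_injOn_of_degree_le [Fintype V] [Fintype W] [DecidableRel G.Adj]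
    [DecidableRel H.Adj] (φ : H →g G) (hinj : ∀ w, Set.InjOn φ (H.neighborSet w))
    (hdeg : ∀ w, G.degree (φ w) ≤ H.degree w) : IsGraphCovering H G φ := fun w =>
  have hmaps : Set.MapsTo φ (H.neighborSet w) (G.neighborSet (φ w)) := fun _ h => φ.map_adj h
  ⟨hmaps, hinj w, by
    simpa using Finset.surjOn_of_injOn_of_card_le (s := H.neighborFinset w)
      (t := G.neighborFinset (φ w)) φ (by simpa using hmaps) (by simpa using hinj w)
      (by simpa using hdeg w)⟩

theorem isGraphCovering_of_component_iso {C : G.ConnectedComponent} (e : C.toSimpleGraph ≃g H) :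
    IsGraphCovering H G fun w => (e.symm w : V) := by
  refine fun w => ⟨fun w' h => ?_, fun a _ b _ hab => e.symm.injective (Subtype.ext hab),
    fun v hv => ?_⟩
  · exact e.symm.map_adj_iff.2 h
  · have hvC : v ∈ C := C.mem_supp_of_adj_mem_supp (e.symm w).2 hv
    refine ⟨e ⟨v, hvC⟩, ?_, by simp⟩
    rw [mem_neighborSet, ← e.symm.map_adj_iff, e.symm_apply_apply]
    exact hv

namespace IsGraphCovering

theorem map_adj (hφ : IsGraphCovering H G φ) {a b : W} (h : H.Adj a b) : G.Adj (φ a) (φ b) :=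
  (hφ a).mapsTo h

theorem adjMatrix_mulVec_comp [Fintype V] [Fintype W] [DecidableRel G.Adj] [DecidableRel H.Adj]
    {R : Type*} [NonAssocSemiring R] (hφ : IsGraphCovering H G φ) (x : V → R) :
    H.adjMatrix R *ᵥ (x ∘ φ) = (G.adjMatrix R *ᵥ x) ∘ φ := by
  funext w
  rw [Function.comp_apply, adjMatrix_mulVec_apply, adjMatrix_mulVec_apply]
  exact Finset.sum_nbij φ (by simpa using fun _ => hφ.map_adj) (by simpa using (hφ w).injOn)
    (by simpa using (hφ w).surjOn) fun _ _ => rfl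

theorem map_reachable (hφ : IsGraphCovering H G φ) {a b : W} (h : H.Reachable a b) :
    G.Reachable (φ a) (φ b) :=
  h.map ⟨φ, hφ.map_adj⟩

theorem mem_range_of_reachable (hφ : IsGraphCovering H G φ) {u v : V} (h : G.Reachable u v)
    (hu : u ∈ Set.range φ) : v ∈ Set.range φ := by
  obtain ⟨p⟩ := h
  induction p with
  | nil => exact hu
  | cons huv _ ih =>
    obtain ⟨w, rfl⟩ := hu
    obtain ⟨w', -, rfl⟩ := (hφ w).surjOn huv
    exact ih ⟨w', rfl⟩

theorem nonempty_component_iso (hφ : IsGraphCovering H G φ) (hinj : Function.Injective φ)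
    (hH : H.Preconnected) (w : W) :
    Nonempty ((G.connectedComponentMk (φ w)).toSimpleGraph ≃g H) := by
  let C := G.connectedComponentMk (φ w)
  let ψ : W → C := fun a => ⟨φ a, ConnectedComponent.sound (hφ.map_reachable (hH a w))⟩
  have hψ : Function.Bijective ψ := by
    refine ⟨fun a b hab => hinj (Subtype.ext_iff.1 hab), fun ⟨v, hv⟩ => ?_⟩
    obtain ⟨a, rfl⟩ := hφ.mem_range_of_reachable (ConnectedComponent.exact hv).symm ⟨w, rfl⟩
    exact ⟨a, rfl⟩
  refine ⟨RelIso.symm ⟨Equiv.ofBijective ψ hψ, fun {a b} => ⟨fun hab => ?_, hφ.map_adj⟩⟩⟩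
  obtain ⟨b', hb', hbb'⟩ := (hφ a).surjOn hab
  exact hinj hbb' ▸ hb'

end IsGraphCovering

end Covering

section Collinearity

open SimpleGraph Matrix

variable {V : Type*} {G : SimpleGraph V}

/-- Two distinct vertices are collinear when they have a common neighbour. If `G` is the incidence
graph of a geometry, then points are collinear when they lie on a common line, and lines when they
meet. -/
def collinearityGraph (G : SimpleGraph V) : SimpleGraph V where
  Adj u v := u ≠ v ∧ ∃ w, G.Adj u w ∧ G.Adj v w
  symm := ⟨fun _ _ h => ⟨h.1.symm, h.2.imp fun _ => And.symm⟩⟩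
  loopless := ⟨fun _ h => h.1 rfl⟩

instance [Fintype V] [DecidableEq V] [DecidableRel G.Adj] :
    DecidableRel (collinearityGraph G).Adj :=
  fun u v => inferInstanceAs (Decidable (u ≠ v ∧ ∃ w, G.Adj u w ∧ G.Adj v w))

/-- A graph has no four-cycle when two distinct vertices have at most one common neighbour. -/
def FourCycleFree (G : SimpleGraph V) : Prop :=
  ∀ ⦃u v l m⦄, u ≠ v → G.Adj u l → G.Adj v l → G.Adj u m → G.Adj v m → l = m

variable [Fintype V] [DecidableRel G.Adj]

theorem exists_adj_notMem {v : V} {s : Finset V} (h : s.card < G.degree v) :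
    ∃ w, G.Adj v w ∧ w ∉ s := by
  simpa using Finset.exists_mem_notMem_of_card_lt_card h

theorem mem_of_adj_of_degree_le_card {v w : V} {s : Finset V} (hs : ∀ u ∈ s, G.Adj v u)
    (hcard : G.degree v ≤ s.card) (hw : G.Adj v w) : w ∈ s := by
  rw [Finset.eq_of_subset_of_card_le (fun u hu => (G.mem_neighborFinset v u).2 (hs u hu)) hcard]
  simpa using hw

variable [DecidableEq V]

theorem adjMatrix_sq_apply {R : Type*} [NonAssocSemiring R] (u v : V) :
    (G.adjMatrix R * G.adjMatrix R) u v = (G.neighborFinset u ∩ G.neighborFinset v).card := by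
  rw [← Finset.filter_mem_eq_inter]
  simp only [adjMatrix_mul_apply, adjMatrix_apply, Finset.sum_boole, mem_neighborFinset,
    G.adj_comm v]

theorem FourCycleFree.card_neighborFinset_inter (h4 : FourCycleFree G) {u v : V} (huv : u ≠ v) :
    (G.neighborFinset u ∩ G.neighborFinset v).card =
      if (collinearityGraph G).Adj u v then 1 else 0 := by
  split_ifs with h
  · obtain ⟨-, w, huw, hvw⟩ := h
    refine Finset.card_eq_one.2 ⟨w, Finset.eq_singleton_iff_unique_mem.2 ⟨by simp [huw, hvw], ?_⟩⟩
    simp only [Finset.mem_inter, mem_neighborFinset, and_imp]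
    exact fun w' huw' hvw' => h4 huv huw' hvw' huw hvw
  · simp only [Finset.card_eq_zero, Finset.eq_empty_iff_forall_notMem, Finset.mem_inter,
      mem_neighborFinset]
    exact fun w hw => h ⟨huv, w, hw⟩

theorem FourCycleFree.adjMatrix_sq_sub_one {R : Type*} [Ring R] (h4 : FourCycleFree G) :
    G.adjMatrix R ^ 2 - 1 =
      diagonal (fun v => (G.degree v - 1 : R)) + (collinearityGraph G).adjMatrix R := by
  ext u v
  rw [sq, Matrix.sub_apply, adjMatrix_sq_apply, Matrix.add_apply, adjMatrix_apply]
  obtain rfl | huv := eq_or_ne u v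
  · simp
  · simp [huv, h4.card_neighborFinset_inter huv]

end Collinearity

section PosDef

open SimpleGraph Matrix

variable {V : Type*}

theorem two_mul_apply_lt_of_posDef {M : Matrix V V ℝ} (hM : M.PosDef) {u v : V} (h : u ≠ v) :
    2 * M u v < M u u + M v v := by
  have hinj : Function.Injective ![u, v] := by
    simp [Function.Injective, Fin.forall_fin_two, h, h.symm]
  have hpos := (hM.submatrix hinj).dotProduct_mulVec_pos (x := ![1, -1])
    fun h => by simpa using congrFun h 0
  have hsymm : M v u = M u v := by simpa using hM.isHermitian.apply u v
  simp [dotProduct, mulVec, Fin.sum_univ_two, hsymm] at hpos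
  linarith

variable [DecidableEq V] {K : SimpleGraph V} [DecidableRel K.Adj] {d : V → ℝ} {p a b q : V}

theorem not_adj_of_posDef (hM : (diagonal d + K.adjMatrix ℝ).PosDef) (ha : d a ≤ 1)
    (hb : d b ≤ 1) : ¬ K.Adj a b := fun hab => by
  have hlt := two_mul_apply_lt_of_posDef hM hab.ne
  simp [hab, hab.ne] at hlt
  linarith

theorem adj_of_posDef_of_adj (hM : (diagonal d + K.adjMatrix ℝ).PosDef) (hp : d p ≤ 1)
    (ha : d a ≤ 2) (hb : d b ≤ 2) (hpa : K.Adj p a) (hpb : K.Adj p b) (hab : a ≠ b) :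
    K.Adj a b := by
  by_contra hnot
  have hinj : Function.Injective ![p, a, b] := by
    simp [Function.Injective, Fin.forall_fin_succ, hab, hab.symm, hpa.ne, hpa.ne', hpb.ne, hpb.ne']
  have hpos := (hM.submatrix hinj).dotProduct_mulVec_pos (x := ![-2, 1, 1])
    fun h => by simpa using congrFun h 1
  simp [dotProduct, mulVec, Fin.sum_univ_three, diagonal_apply, hpa, hpb, hpa.symm, hpb.symm,
    hnot, K.adj_comm b a, hab, hab.symm, hpa.ne, hpa.ne', hpb.ne, hpb.ne'] at hpos
  linarith

theorem adj_of_posDef_of_diamond (hM : (diagonal d + K.adjMatrix ℝ).PosDef) (hp : d p ≤ 1)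
    (ha : d a ≤ 2) (hb : d b ≤ 2) (hq : d q ≤ 2) (hpa : K.Adj p a) (hpb : K.Adj p b)
    (hab : K.Adj a b) (hqa : K.Adj q a) (hqb : K.Adj q b) (hpq : p ≠ q) : K.Adj p q := by
  by_contra hnot
  have hinj : Function.Injective ![p, a, b, q] := by
    simp [Function.Injective, Fin.forall_fin_succ, hab.ne, hab.ne', hpa.ne, hpa.ne', hpb.ne,
      hpb.ne', hqa.ne, hqa.ne', hqb.ne, hqb.ne', hpq, hpq.symm]
  have hpos := (hM.submatrix hinj).dotProduct_mulVec_pos (x := ![2, -1, -1, 1])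
    fun h => by simpa using congrFun h 1
  simp [dotProduct, mulVec, Fin.sum_univ_four, diagonal_apply, hnot, hpa, hpb, hpa.symm, hpb.symm,
    hab, hab.symm, hqa, hqa.symm, hqb, hqb.symm, K.adj_comm q p, hab.ne, hab.ne', hpa.ne, hpa.ne',
    hpb.ne, hpb.ne', hqa.ne, hqa.ne', hqb.ne, hqb.ne', hpq, hpq.symm] at hpos
  linarith

end PosDef

section Regularity

open SimpleGraph Matrix

variable {V : Type*} [Fintype V] [DecidableEq V] {G : SimpleGraph V} [DecidableRel G.Adj]

theorem two_le_degree_of_posDef (hP : (G.adjMatrix ℝ ^ 2 - 1).PosDef) (v : V) :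
    2 ≤ G.degree v := by
  have hpos := hP.diag_pos (i := v)
  rw [sq, Matrix.sub_apply, adjMatrix_mul_self_apply_self, one_apply_eq] at hpos
  have : (1 : ℝ) < G.degree v := by linarith
  exact_mod_cast this

theorem fourCycleFree_of_posDef (hP : (G.adjMatrix ℝ ^ 2 - 1).PosDef)
    (hdeg : ∀ v, G.degree v ≤ 3) : FourCycleFree G := by
  intro u v l m huv hul hvl hum hvm
  have hlt := two_mul_apply_lt_of_posDef hP huv
  simp only [sq, Matrix.sub_apply, adjMatrix_sq_apply, one_apply_ne huv, one_apply_eq, sub_zero,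
    Finset.inter_self, card_neighborFinset_eq_degree] at hlt
  have hu : (G.degree u : ℝ) ≤ 3 := by exact_mod_cast hdeg u
  have hv : (G.degree v : ℝ) ≤ 3 := by exact_mod_cast hdeg v
  have hcard : (G.neighborFinset u ∩ G.neighborFinset v).card < 2 := by
    exact_mod_cast (by linarith : ((G.neighborFinset u ∩ G.neighborFinset v).card : ℝ) < 2)
  exact Finset.card_le_one.1 (Nat.le_of_lt_succ hcard) l (by simp [hul, hvl]) m (by simp [hum, hvm])

theorem not_collinear_of_degree_eq_two (hP : (G.adjMatrix ℝ ^ 2 - 1).PosDef)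
    (hdeg : ∀ v, G.degree v ≤ 3) {u v : V} (hu : G.degree u = 2) (hv : G.degree v = 2) :
    ¬ (collinearityGraph G).Adj u v := by
  have hM := (fourCycleFree_of_posDef hP hdeg).adjMatrix_sq_sub_one (R := ℝ) ▸ hP
  exact not_adj_of_posDef hM (by rw [hu]; norm_num) (by rw [hv]; norm_num)

theorem exists_degree_eq_two_of_degree_eq_two (hP : (G.adjMatrix ℝ ^ 2 - 1).PosDef)
    (hdeg : ∀ v, G.degree v ≤ 3) {p l₁ l₂ a b : V} (hp : G.degree p = 2) (hl : l₁ ≠ l₂)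
    (hp₁ : G.Adj p l₁) (hp₂ : G.Adj p l₂) (ha : G.Adj a l₁) (hb : G.Adj b l₂) (hpa : p ≠ a)
    (hpb : p ≠ b) : ∃ m, G.Adj a m ∧ G.Adj b m ∧ G.degree m = 2 := by
  have h4 := fourCycleFree_of_posDef hP hdeg
  have hM := h4.adjMatrix_sq_sub_one (R := ℝ) ▸ hP
  have hp1 : (G.degree p - 1 : ℝ) ≤ 1 := by rw [hp]; norm_num
  have hd2 : ∀ v, (G.degree v - 1 : ℝ) ≤ 2 := fun v => by
    have : (G.degree v : ℝ) ≤ 3 := by exact_mod_cast hdeg v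
    linarith
  have hcpa : (collinearityGraph G).Adj p a := ⟨hpa, l₁, hp₁, ha⟩
  have hcpb : (collinearityGraph G).Adj p b := ⟨hpb, l₂, hp₂, hb⟩
  have hab : a ≠ b := by
    rintro rfl
    exact hl (h4 hpa hp₁ ha hp₂ hb)
  have hcab := adj_of_posDef_of_adj hM hp1 (hd2 a) (hd2 b) hcpa hcpb hab
  obtain ⟨m, ham, hbm⟩ := hcab.2
  refine ⟨m, ham, hbm, ?_⟩
  by_contra hm2
  have hl₁m : l₁ ≠ m := by
    rintro rfl
    exact hl (h4 hpb hp₁ hbm hp₂ hb)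
  have hl₂m : l₂ ≠ m := by
    rintro rfl
    exact hl (h4 hpa hp₁ ha hp₂ ham)
  have hp_lines : ∀ l, G.Adj p l → l = l₁ ∨ l = l₂ := fun l h => by
    simpa using mem_of_adj_of_degree_le_card (s := {l₁, l₂}) (by simp [hp₁, hp₂])
      (by rw [hp, Finset.card_pair hl]) h
  obtain ⟨q, hmq, hq⟩ : ∃ q, G.Adj m q ∧ q ∉ ({a, b} : Finset V) :=
    exists_adj_notMem (Finset.card_le_two.trans_lt
      (lt_of_le_of_ne (two_le_degree_of_posDef hP m) (Ne.symm hm2)))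
  simp only [Finset.mem_insert, Finset.mem_singleton, not_or] at hq
  have hpq : p ≠ q := by
    rintro rfl
    exact (hp_lines m hmq.symm).elim hl₁m.symm hl₂m.symm
  obtain ⟨-, w, hpw, hqw⟩ := adj_of_posDef_of_diamond hM hp1 (hd2 a) (hd2 b) (hd2 q) hcpa hcpb
    hcab ⟨hq.1, m, hmq.symm, ham⟩ ⟨hq.2, m, hmq.symm, hbm⟩ hpq
  obtain rfl | rfl := hp_lines w hpw
  · exact hl₁m (h4 hq.1 hqw ha hmq.symm ham)
  · exact hl₂m (h4 hq.2 hqw hb hmq.symm hbm)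

theorem degree_eq_two_of_adj_of_degree_eq_two (hP : (G.adjMatrix ℝ ^ 2 - 1).PosDef)
    (hdeg : ∀ v, G.degree v ≤ 3) {p l₁ l₂ : V} (hp : G.degree p = 2) (hl : l₁ ≠ l₂)
    (hp₁ : G.Adj p l₁) (hp₂ : G.Adj p l₂) : G.degree l₂ = 2 := by
  have h4 := fourCycleFree_of_posDef hP hdeg
  by_contra hl₂
  have hl₂3 : 2 < G.degree l₂ := lt_of_le_of_ne (two_le_degree_of_posDef hP l₂) (Ne.symm hl₂)
  obtain ⟨a, ha, hpa⟩ : ∃ a, G.Adj l₁ a ∧ a ∉ ({p} : Finset V) :=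
    exists_adj_notMem (two_le_degree_of_posDef hP l₁)
  obtain ⟨b, hb, hpb⟩ : ∃ b, G.Adj l₂ b ∧ b ∉ ({p} : Finset V) :=
    exists_adj_notMem ((Finset.card_singleton p).trans_lt (by omega))
  obtain ⟨b', hb', hpb'⟩ : ∃ b', G.Adj l₂ b' ∧ b' ∉ ({p, b} : Finset V) :=
    exists_adj_notMem (Finset.card_le_two.trans_lt hl₂3)
  simp only [Finset.mem_insert, Finset.mem_singleton, not_or] at hpa hpb hpb'
  obtain ⟨m, ham, hbm, hm⟩ := exists_degree_eq_two_of_degree_eq_two hP hdeg hp hl hp₁ hp₂ ha.symm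
    hb.symm (Ne.symm hpa) (Ne.symm hpb)
  obtain ⟨m', ham', hbm', hm'⟩ := exists_degree_eq_two_of_degree_eq_two hP hdeg hp hl hp₁ hp₂
    ha.symm hb'.symm (Ne.symm hpa) (Ne.symm hpb'.1)
  refine not_collinear_of_degree_eq_two hP hdeg hm hm' ⟨?_, a, ham.symm, ham'.symm⟩
  rintro rfl
  exact hl₂ (h4 hpb'.2 hbm' hbm hb'.symm hb.symm ▸ hm)

theorem isRegularOfDegree_three_of_posDef (hP : (G.adjMatrix ℝ ^ 2 - 1).PosDef)
    (hdeg : ∀ v, G.degree v ≤ 3) : G.IsRegularOfDegree 3 := by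
  intro p
  have hp2 := two_le_degree_of_posDef hP p
  by_contra hp3
  have hp : G.degree p = 2 := by have := hdeg p; omega
  obtain ⟨l, hl, -⟩ : ∃ l, G.Adj p l ∧ l ∉ (∅ : Finset V) :=
    exists_adj_notMem (Finset.card_empty.trans_lt (by omega))
  obtain ⟨l', hl', hne⟩ : ∃ l', G.Adj p l' ∧ l' ∉ ({l} : Finset V) := exists_adj_notMem hp2
  rw [Finset.mem_singleton] at hne
  exact not_collinear_of_degree_eq_two hP hdeg
    (degree_eq_two_of_adj_of_degree_eq_two hP hdeg hp hne hl' hl)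
    (degree_eq_two_of_adj_of_degree_eq_two hP hdeg hp (Ne.symm hne) hl hl')
    ⟨Ne.symm hne, p, hl.symm, hl'.symm⟩

end Regularity

section Lattice

open Matrix

variable {ι R : Type*}

/-- The symmetric matrix `M` bordered by the vector `b`, with corner entry `c`. -/
def borderedMatrix (M : Matrix ι ι R) (b : ι → R) (c : R) : Matrix (ι ⊕ Unit) (ι ⊕ Unit) R :=
  fromBlocks M (replicateCol Unit b) (replicateRow Unit b) (of fun _ _ => c)

theorem map_borderedMatrix {S : Type*} (f : R → S) (M : Matrix ι ι R) (b : ι → R) (c : R) :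
    (borderedMatrix M b c).map f = borderedMatrix (M.map f) (f ∘ b) (f c) := by
  rw [borderedMatrix, fromBlocks_map]
  rfl

theorem submatrix_sumElim_eq_borderedMatrix {V : Type*} {P : Matrix V V R} (hP : P.IsSymm)
    (e : ι → V) (v : V) :
    P.submatrix (Sum.elim e fun _ : Unit => v) (Sum.elim e fun _ => v) =
      borderedMatrix (P.submatrix e e) (fun i => P (e i) v) (P v v) := by
  ext (i | i) (j | j) <;> simp [borderedMatrix, hP.apply v]

variable [Fintype ι]

theorem borderedMatrix_mulVec [CommSemiring R] (M : Matrix ι ι R) (b : ι → R) (c : R) (x : ι → R)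
    (t : R) : borderedMatrix M b c *ᵥ Sum.elim x (fun _ => t) =
      Sum.elim (M *ᵥ x + t • b) fun _ => b ⬝ᵥ x + c * t := by
  rw [borderedMatrix, fromBlocks_mulVec]
  ext (i | i) <;> simp [mulVec, dotProduct, mul_comm]

variable [DecidableEq ι]

theorem dvd_det_of_mulVec_one [CommRing R] [Nonempty ι] {M : Matrix ι ι R} {k : R}
    (h : M *ᵥ 1 = k • 1) : k ∣ M.det := by
  have hadj : M.adjugate *ᵥ (M *ᵥ 1) = M.det • 1 := by
    rw [mulVec_mulVec, adjugate_mul, smul_mulVec, one_mulVec]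
  rw [h, mulVec_smul] at hadj
  obtain ⟨i⟩ := ‹Nonempty ι›
  exact ⟨_, by simpa using (congrFun hadj i).symm⟩

section Field

variable [Field R] {M : Matrix ι ι R} {b : ι → R} {c : R}

theorem det_borderedMatrix (hM : IsUnit M.det) :
    (borderedMatrix M b c).det = M.det * (c - b ⬝ᵥ M⁻¹ *ᵥ b) := by
  let := M.invertibleOfIsUnitDet hM
  rw [borderedMatrix, det_fromBlocks₁₁, det_unique (n := Unit), invOf_eq_nonsing_inv,
    Matrix.sub_apply, Matrix.mul_assoc]
  congr 2

/-- Completing the square in the last variable. -/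
theorem dotProduct_inv_borderedMatrix (hM : IsUnit M.det) (hsymm : M.IsSymm)
    (hs : c - b ⬝ᵥ M⁻¹ *ᵥ b ≠ 0) (u : ι → R) (m : R) :
    Sum.elim u (fun _ => m) ⬝ᵥ (borderedMatrix M b c)⁻¹ *ᵥ Sum.elim u (fun _ => m) =
      u ⬝ᵥ M⁻¹ *ᵥ u + (m - b ⬝ᵥ M⁻¹ *ᵥ u) ^ 2 / (c - b ⬝ᵥ M⁻¹ *ᵥ b) := by
  set s := c - b ⬝ᵥ M⁻¹ *ᵥ b with hs_def
  set t := (m - b ⬝ᵥ M⁻¹ *ᵥ u) / s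
  have hts : t * s = m - b ⬝ᵥ M⁻¹ *ᵥ u := div_mul_cancel₀ _ hs
  have hdet : IsUnit (borderedMatrix M b c).det := by
    rw [det_borderedMatrix hM]
    exact hM.mul hs.isUnit
  have hsolve : borderedMatrix M b c *ᵥ Sum.elim (M⁻¹ *ᵥ (u - t • b)) (fun _ => t) =
      Sum.elim u fun _ => m := by
    have hrow : b ⬝ᵥ (M⁻¹ *ᵥ (u - t • b)) + c * t = m := by
      rw [mulVec_sub, mulVec_smul, dotProduct_sub, dotProduct_smul, smul_eq_mul]
      linear_combination hts - t * hs_def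
    rw [borderedMatrix_mulVec, hrow, mulVec_mulVec, mul_nonsing_inv _ hM, one_mulVec,
      sub_add_cancel]
  have hinv : (borderedMatrix M b c)⁻¹ *ᵥ Sum.elim u (fun _ => m) =
      Sum.elim (M⁻¹ *ᵥ (u - t • b)) fun _ => t := by
    rw [← hsolve, mulVec_mulVec, nonsing_inv_mul _ hdet, one_mulVec]
  have hcomm : u ⬝ᵥ M⁻¹ *ᵥ b = b ⬝ᵥ M⁻¹ *ᵥ u := by
    rw [dotProduct_mulVec, ← mulVec_transpose, transpose_nonsing_inv, hsymm.eq, dotProduct_comm]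
  rw [hinv, sumElim_dotProduct_sumElim, mulVec_sub, mulVec_smul, dotProduct_sub, dotProduct_smul,
    hcomm]
  rw [show (fun _ : Unit => m) ⬝ᵥ (fun _ => t) = m * t from Fintype.sum_unique _, smul_eq_mul,
    ← hts, mul_pow, sq s, ← mul_assoc, mul_div_cancel_right₀ _ hs]
  linear_combination - t * hts

end Field

theorem schur_pos_of_posDef {M : Matrix ι ι ℝ} {b : ι → ℝ} {c : ℝ} (hM : M.PosDef)
    (hN : (borderedMatrix M b c).PosDef) : 0 < c - b ⬝ᵥ M⁻¹ *ᵥ b := by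
  have hpos := hN.det_pos
  rw [det_borderedMatrix hM.det_pos.ne'.isUnit] at hpos
  exact pos_of_mul_pos_right hpos hM.det_pos.le

/-- For the Gram matrix `M` of a basis of an integral lattice: every nonzero vector of the dual
lattice, whose Gram matrix in the dual basis is `M⁻¹`, has norm at least `1`. -/
def DualMinGeOne (M : Matrix ι ι ℤ) : Prop :=
  ∀ z : ι → ℤ, z ≠ 0 →
    1 ≤ (Int.cast ∘ z : ι → ℝ) ⬝ᵥ (M.map (Int.cast : ℤ → ℝ))⁻¹ *ᵥ (Int.cast ∘ z)

theorem one_le_of_pos_of_eq_intCast {x : ℝ} {n : ℤ} (hx : 0 < x) (h : x = n) : 1 ≤ x := by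
  subst h
  exact_mod_cast Int.cast_pos.1 hx

theorem dualMinGeOne_of_mul_add_transpose {M T : Matrix ι ι ℤ}
    (hM : (M.map (Int.cast : ℤ → ℝ)).PosDef) (hT : M * (T + Tᵀ) = 2) : DualMinGeOne M := by
  intro z hz
  set x : ι → ℝ := Int.cast ∘ z with hx
  have hx0 : x ≠ 0 := fun h => hz (funext fun i => by simpa [hx] using congrFun h i)
  have hinv : (M.map (Int.cast : ℤ → ℝ))⁻¹ =
      (2⁻¹ : ℝ) • (T.map (Int.cast : ℤ → ℝ) + (T.map (Int.cast : ℤ → ℝ))ᵀ) := by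
    refine inv_eq_right_inv ?_
    have hTr := congrArg (Int.castRingHom ℝ).mapMatrix hT
    rw [map_mul, map_add, map_ofNat] at hTr
    change M.map (Int.cast : ℤ → ℝ) * (T.map Int.cast + (T.map Int.cast)ᵀ) = 2 at hTr
    rw [Matrix.mul_smul, hTr, inv_smul_eq_iff₀ two_ne_zero, two_smul, one_add_one_eq_two]
  have heq : x ⬝ᵥ (M.map (Int.cast : ℤ → ℝ))⁻¹ *ᵥ x = ((z ⬝ᵥ T *ᵥ z : ℤ) : ℝ) := by
    have hcast : ((z ⬝ᵥ T *ᵥ z : ℤ) : ℝ) = x ⬝ᵥ T.map (Int.cast : ℤ → ℝ) *ᵥ x := by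
      simp [hx, dotProduct, mulVec]
    rw [hinv, smul_mulVec, add_mulVec, dotProduct_smul, dotProduct_add, mulVec_transpose,
      dotProduct_comm x (x ᵥ* _), ← dotProduct_mulVec, hcast, smul_eq_mul]
    ring
  exact one_le_of_pos_of_eq_intCast (hM.inv.dotProduct_mulVec_pos hx0) heq

section Border

variable {M : Matrix ι ι ℤ} {b : ι → ℤ}

theorem DualMinGeOne.det_borderedMatrix_le (h : DualMinGeOne M)
    (hM : (M.map (Int.cast : ℤ → ℝ)).PosDef) (hb : b ≠ 0) :
    (borderedMatrix M b 2).det ≤ M.det := by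
  have hle : ((borderedMatrix M b 2).map (Int.cast : ℤ → ℝ)).det ≤
      (M.map (Int.cast : ℤ → ℝ)).det := by
    rw [map_borderedMatrix, det_borderedMatrix hM.det_pos.ne'.isUnit, Int.cast_ofNat]
    exact mul_le_of_le_one_right hM.det_pos.le (by linarith [h b hb])
  rw [← Int.cast_det, ← Int.cast_det] at hle
  exact_mod_cast hle

theorem DualMinGeOne.borderedMatrix (h : DualMinGeOne M) (hM : (M.map (Int.cast : ℤ → ℝ)).PosDef)
    (hb : b ≠ 0) (hN : ((borderedMatrix M b 2).map (Int.cast : ℤ → ℝ)).PosDef) :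
    DualMinGeOne (borderedMatrix M b 2) := by
  intro z hz
  obtain ⟨u, m, rfl⟩ : ∃ u m, z = Sum.elim u fun _ => m :=
    ⟨z ∘ Sum.inl, z (Sum.inr ()), by ext (i | i) <;> rfl⟩
  have hz' : (Int.cast ∘ Sum.elim u fun _ => m : ι ⊕ Unit → ℝ) =
      Sum.elim (Int.cast ∘ u) fun _ => (m : ℝ) := Sum.comp_elim _ _ _
  have hs1 : 1 ≤ (Int.cast ∘ b : ι → ℝ) ⬝ᵥ (M.map Int.cast)⁻¹ *ᵥ (Int.cast ∘ b) := h b hb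
  rw [map_borderedMatrix, Int.cast_ofNat] at hN ⊢
  have hs := schur_pos_of_posDef hM hN
  rw [hz', dotProduct_inv_borderedMatrix hM.det_pos.ne'.isUnit hM.isHermitian hs.ne']
  by_cases hu : u = 0
  · have hm : m ≠ 0 := fun hm => hz (by ext (i | i) <;> simp [hu, hm])
    have hm1 : (1 : ℝ) ≤ (m : ℝ) ^ 2 := by
      exact_mod_cast Int.one_le_abs (pow_ne_zero 2 hm) |>.trans_eq (abs_sq m)
    have hcast : (Int.cast ∘ u : ι → ℝ) = 0 := by ext; simp [hu]
    rw [hcast, mulVec_zero, dotProduct_zero, dotProduct_zero, zero_add, sub_zero, one_le_div hs]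
    linarith
  · exact le_add_of_le_of_nonneg (h u hu) (by positivity)

end Border

section Submatrix

variable {V : Type*} [Fintype V] {P : Matrix V V ℤ} {e : ι → V} {k : ℤ}

theorem dvd_det_submatrix_of_rowSum [Nonempty ι] (hrow : P *ᵥ 1 = k • 1)
    (he : Function.Injective e) (hclosed : ∀ v ∉ Set.range e, ∀ i, P (e i) v = 0) :
    k ∣ (P.submatrix e e).det := by
  refine dvd_det_of_mulVec_one (funext fun i => ?_)
  calc (P.submatrix e e *ᵥ 1) i = ∑ j, P (e i) (e j) := by simp [mulVec, dotProduct]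
    _ = ∑ v, P (e i) v :=
      Fintype.sum_of_injective e he _ _ (fun v hv => hclosed v hv i) fun _ => rfl
    _ = (P *ᵥ 1) (e i) := by simp [mulVec, dotProduct]
    _ = (k • 1 : ι → ℤ) i := by rw [hrow]; rfl

theorem exists_dualMinGeOne_extension [Nonempty ι] (hP : (P.map (Int.cast : ℤ → ℝ)).PosDef)
    (hdiag : ∀ v, P v v = 2) (hrow : P *ᵥ 1 = k • 1) (he : Function.Injective e)
    (hdet : (P.submatrix e e).det < k) (h : DualMinGeOne (P.submatrix e e)) :
    ∃ e' : ι ⊕ Unit → V, Function.Injective e' ∧ (P.submatrix e' e').det < k ∧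
      DualMinGeOne (P.submatrix e' e') := by
  have hM : ((P.submatrix e e).map (Int.cast : ℤ → ℝ)).PosDef := hP.submatrix he
  have hpos : 0 < (P.submatrix e e).det := by
    have := hM.det_pos
    rw [← Int.cast_det] at this
    exact_mod_cast this
  obtain ⟨v, hv, i, hi⟩ : ∃ v ∉ Set.range e, ∃ i, P (e i) v ≠ 0 := by
    by_contra! hclosed
    exact hdet.not_ge (Int.le_of_dvd hpos (dvd_det_submatrix_of_rowSum hrow he hclosed))
  have hb : (fun i => P (e i) v) ≠ 0 := fun h0 => hi (congrFun h0 i)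
  have hinj : Function.Injective (Sum.elim e fun _ : Unit => v) :=
    he.sumElim (Function.injective_of_subsingleton _) fun j _ hj => hv ⟨j, hj⟩
  have hsymm : P.IsSymm := by
    ext u w
    simpa using hP.isHermitian.apply u w
  have hN : ((P.submatrix _ _).map (Int.cast : ℤ → ℝ)).PosDef := hP.submatrix hinj
  refine ⟨_, hinj, ?_⟩
  rw [submatrix_sumElim_eq_borderedMatrix hsymm, hdiag] at hN ⊢
  exact ⟨(h.det_borderedMatrix_le hM hb).trans_lt hdet, h.borderedMatrix hM hb hN⟩

theorem not_dualMinGeOne_submatrix [Nonempty ι] (hP : (P.map (Int.cast : ℤ → ℝ)).PosDef)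
    (hdiag : ∀ v, P v v = 2) (hrow : P *ᵥ 1 = k • 1) (he : Function.Injective e)
    (hdet : (P.submatrix e e).det < k) : ¬ DualMinGeOne (P.submatrix e e) := by
  intro h
  obtain ⟨n, hn⟩ := Nat.exists_eq_add_of_le (Fintype.card_le_of_injective e he)
  induction n generalizing ι with
  | zero =>
    obtain ⟨e', he', -⟩ := exists_dualMinGeOne_extension hP hdiag hrow he hdet h
    have := Fintype.card_le_of_injective e' he'
    rw [Fintype.card_sum, Fintype.card_unit] at this
    omega
  | succ n ih =>
    obtain ⟨e', he', hdet', h'⟩ := exists_dualMinGeOne_extension hP hdiag hrow he hdet h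
    exact ih he' hdet' h' (by rw [Fintype.card_sum, Fintype.card_unit]; omega)

end Submatrix

end Lattice

section Forbidden

open SimpleGraph Matrix

variable {V : Type*}

/-- A graph is claw-free when it has no induced `K_{1,3}`. -/
def ClawFree (K : SimpleGraph V) : Prop :=
  ∀ ⦃p a b c⦄, K.Adj p a → K.Adj p b → K.Adj p c → a ≠ b → a ≠ c → b ≠ c →
    K.Adj a b ∨ K.Adj a c ∨ K.Adj b c

/-- A graph is diamond-free when it has no induced `K₄` minus an edge. -/
def DiamondFree (K : SimpleGraph V) : Prop :=
  ∀ ⦃a b c d⦄, K.Adj a b → K.Adj a c → K.Adj b c → K.Adj a d → K.Adj b d → c ≠ d → K.Adj c d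

variable [Fintype V] [DecidableEq V] {K : SimpleGraph V} [DecidableRel K.Adj] {k : ℕ}

theorem two_add_adjMatrix_mulVec_one {R : Type*} [CommRing R] (hK : K.IsRegularOfDegree k) :
    (2 + K.adjMatrix R) *ᵥ 1 = (2 + k : R) • 1 := by
  ext v
  simp [add_mulVec, ofNat_mulVec, adjMatrix_mulVec_apply, hK v]

theorem two_add_le_det_of_mul_add_transpose {n : ℕ} [NeZero n] {M T : Matrix (Fin n) (Fin n) ℤ}
    (hP : (2 + K.adjMatrix ℝ).PosDef) (hK : K.IsRegularOfDegree k) {e : Fin n → V}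
    (he : Function.Injective e) (hM : (2 + K.adjMatrix ℤ).submatrix e e = M)
    (hT : M * (T + Tᵀ) = 2) : 2 + k ≤ M.det := by
  have hmap : (2 + K.adjMatrix ℤ).map (Int.cast : ℤ → ℝ) = 2 + K.adjMatrix ℝ := by
    ext u v
    simp [adjMatrix_apply, ofNat_apply, apply_ite (Int.cast : ℤ → ℝ)]
  subst hM
  rw [← hmap] at hP
  by_contra! hdet
  exact not_dualMinGeOne_submatrix hP (by simp [ofNat_apply]) (two_add_adjMatrix_mulVec_one hK) he
    hdet (dualMinGeOne_of_mul_add_transpose (hP.submatrix he) hT)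

theorem clawFree_of_posDef (hP : (2 + K.adjMatrix ℝ).PosDef) (hK : K.IsRegularOfDegree k)
    (hk : 3 ≤ k) : ClawFree K := by
  intro p a b c hpa hpb hpc hab hac hbc
  by_contra! h
  have hinj : Function.Injective ![p, a, b, c] := by
    simp [Function.Injective, Fin.forall_fin_succ, hab, hac, hbc, hab.symm, hac.symm, hbc.symm,
      hpa.ne, hpa.ne', hpb.ne, hpb.ne', hpc.ne, hpc.ne']
  have hM : (2 + K.adjMatrix ℤ).submatrix ![p, a, b, c] ![p, a, b, c] =
      !![2, 1, 1, 1; 1, 2, 0, 0; 1, 0, 2, 0; 1, 0, 0, 2] := by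
    ext i j
    fin_cases i <;> fin_cases j <;>
      simp [ofNat_apply, hpa, hpb, hpc, hpa.symm, hpb.symm, hpc.symm, h, K.adj_comm b a,
        K.adj_comm c a, K.adj_comm c b, hab, hac, hbc, hab.symm, hac.symm, hbc.symm, hpa.ne,
        hpa.ne', hpb.ne, hpb.ne', hpc.ne, hpc.ne']
  have hdet := two_add_le_det_of_mul_add_transpose hP hK hinj hM
    (T := !![2, -2, -2, -2; 0, 1, 1, 1; 0, 0, 1, 1; 0, 0, 0, 1]) (by decide)
  have : det !![(2 : ℤ), 1, 1, 1; 1, 2, 0, 0; 1, 0, 2, 0; 1, 0, 0, 2] = 4 := by decide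
  omega

theorem diamondFree_of_posDef (hP : (2 + K.adjMatrix ℝ).PosDef) (hK : K.IsRegularOfDegree k)
    (hk : 3 ≤ k) : DiamondFree K := by
  intro a b c d hab hac hbc had hbd hcd
  by_contra h
  have hinj : Function.Injective ![a, b, c, d] := by
    simp [Function.Injective, Fin.forall_fin_succ, hab.ne, hab.ne', hac.ne, hac.ne', hbc.ne,
      hbc.ne', had.ne, had.ne', hbd.ne, hbd.ne', hcd, hcd.symm]
  have hM : (2 + K.adjMatrix ℤ).submatrix ![a, b, c, d] ![a, b, c, d] =
      !![2, 1, 1, 1; 1, 2, 1, 1; 1, 1, 2, 0; 1, 1, 0, 2] := by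
    ext i j
    fin_cases i <;> fin_cases j <;>
      simp [ofNat_apply, hab, hac, hbc, had, hbd, hab.symm, hac.symm, hbc.symm, had.symm,
        hbd.symm, h, K.adj_comm d c, hab.ne, hab.ne', hac.ne, hac.ne', hbc.ne, hbc.ne', had.ne,
        had.ne', hbd.ne, hbd.ne', hcd, hcd.symm]
  have hdet := two_add_le_det_of_mul_add_transpose hP hK hinj hM
    (T := !![1, 0, -1, -1; 0, 1, -1, -1; 0, 0, 1, 1; 0, 0, 0, 1]) (by decide)
  have : det !![(2 : ℤ), 1, 1, 1; 1, 2, 1, 1; 1, 1, 2, 0; 1, 1, 0, 2] = 4 := by decide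
  omega

end Forbidden

section ClusterGraph

open SimpleGraph Matrix

variable {V : Type*} {G : SimpleGraph V}

/-- A cluster graph is a disjoint union of cliques. -/
def IsClusterGraph (K : SimpleGraph V) : Prop :=
  ∀ ⦃a p b⦄, K.Adj a p → K.Adj p b → a ≠ b → K.Adj a b

theorem collinearityGraph_adj {a b w : V} (hne : a ≠ b) (ha : G.Adj a w) (hb : G.Adj b w) :
    (collinearityGraph G).Adj a b :=
  ⟨hne, w, ha, hb⟩

theorem FourCycleFree.ne_of_adj_of_adj (h4 : FourCycleFree G) {p l m a b : V} (hl : G.Adj p l)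
    (hm : G.Adj p m) (hlm : l ≠ m) (ha : G.Adj a l) (hap : a ≠ p) (hb : G.Adj b m) : a ≠ b := by
  rintro rfl
  exact hlm (h4 hap ha hl hb hm)

variable [Fintype V] [DecidableRel G.Adj]

theorem exists_adj_of_adj_of_collinear (h4 : FourCycleFree G) (hG : G.IsRegularOfDegree 3)
    (hD : DiamondFree (collinearityGraph G)) {p l₁ l₂ l₃ a c : V} (h₁ : G.Adj p l₁)
    (h₂ : G.Adj p l₂) (h₃ : G.Adj p l₃) (h₁₂ : l₁ ≠ l₂) (h₁₃ : l₁ ≠ l₃) (h₂₃ : l₂ ≠ l₃)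
    (ha : G.Adj a l₁) (hap : a ≠ p) (hc : G.Adj c l₂) (hcp : c ≠ p)
    (hac : (collinearityGraph G).Adj a c) :
    ∃ q, (collinearityGraph G).Adj a q ∧ G.Adj q l₃ ∧ q ≠ p := by
  classical
  obtain ⟨hne, m, ham, hcm⟩ := hac
  have hm₁ : l₁ ≠ m := by
    rintro rfl
    exact h₁₂ (h4 hcp hcm h₁ hc h₂)
  have hm₂ : l₂ ≠ m := by
    rintro rfl
    exact h₁₂ (h4 hap ha h₁ ham h₂)
  obtain ⟨q, hmq, hq⟩ := exists_adj_notMem (G := G) (v := m) (s := {a, c})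
    (Finset.card_le_two.trans_lt (by simp [hG m]))
  obtain ⟨hqa, hqc⟩ : q ≠ a ∧ q ≠ c := by simpa using hq
  have hqp : q ≠ p := by
    rintro rfl
    exact hm₁ (h4 hap ha h₁ ham hmq.symm)
  have haq := collinearityGraph_adj hqa.symm ham hmq.symm
  obtain ⟨-, w, hqw, hpw⟩ := hD (collinearityGraph_adj hne ham hcm) haq
    (collinearityGraph_adj hqc.symm hcm hmq.symm) (collinearityGraph_adj hap ha h₁)
    (collinearityGraph_adj hcp hc h₂) hqp
  have hw : w ∈ ({l₁, l₂, l₃} : Finset V) := mem_of_adj_of_degree_le_card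
    (by simp [h₁, h₂, h₃]) (by simp [hG p, h₁₂, h₁₃, h₂₃]) hpw
  simp only [Finset.mem_insert, Finset.mem_singleton] at hw
  obtain rfl | rfl | rfl := hw
  · exact absurd (h4 hqa hqw ha hmq.symm ham) hm₁
  · exact absurd (h4 hqc hqw hc hmq.symm hcm) hm₂
  · exact ⟨q, haq, hqw, hqp⟩

theorem collinear_of_collinear_of_third (h4 : FourCycleFree G) (hG : G.IsRegularOfDegree 3)
    (hD : DiamondFree (collinearityGraph G)) {p l₁ l₂ l₃ a b c : V} (h₁ : G.Adj p l₁)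
    (h₂ : G.Adj p l₂) (h₃ : G.Adj p l₃) (h₁₂ : l₁ ≠ l₂) (h₁₃ : l₁ ≠ l₃) (h₂₃ : l₂ ≠ l₃)
    (ha : G.Adj a l₁) (hap : a ≠ p) (hc : G.Adj c l₂) (hcp : c ≠ p) (hb : G.Adj b l₃)
    (hbp : b ≠ p) (hac : (collinearityGraph G).Adj a c) : (collinearityGraph G).Adj a b := by
  obtain ⟨q, haq, hq, hqp⟩ :=
    exists_adj_of_adj_of_collinear h4 hG hD h₁ h₂ h₃ h₁₂ h₁₃ h₂₃ ha hap hc hcp hac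
  obtain rfl | hqb := eq_or_ne q b
  · exact haq
  · exact hD (collinearityGraph_adj hqp.symm h₃ hq) (collinearityGraph_adj hap.symm h₁ ha) haq.symm
      (collinearityGraph_adj hbp.symm h₃ hb) (collinearityGraph_adj hqb hq hb)
      (h4.ne_of_adj_of_adj h₁ h₃ h₁₃ ha hap hb)

/-- If `a` and `b` lie on different lines through `p`, a point `c` on the third line gives a claw
unless two of `a`, `b`, `c` are collinear, and then all three are. -/
theorem isClusterGraph_collinearityGraph (h4 : FourCycleFree G) (hG : G.IsRegularOfDegree 3)
    (hC : ClawFree (collinearityGraph G)) (hD : DiamondFree (collinearityGraph G)) :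
    IsClusterGraph (collinearityGraph G) := by
  classical
  intro a p b hap hpb hab
  have hcollinear := @collinear_of_collinear_of_third V G _ _ h4 hG hD
  by_contra h
  obtain ⟨hap', l₁, ha, h₁⟩ := id hap
  obtain ⟨hpb', l₃, h₃, hb⟩ := id hpb
  have h₁₃ : l₁ ≠ l₃ := by
    rintro rfl
    exact h ⟨hab, l₁, ha, hb⟩
  obtain ⟨l₂, h₂, hl₂⟩ := exists_adj_notMem (G := G) (v := p) (s := {l₁, l₃})
    (Finset.card_le_two.trans_lt (by simp [hG p]))
  obtain ⟨h₂₁, h₂₃⟩ : l₂ ≠ l₁ ∧ l₂ ≠ l₃ := by simpa using hl₂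
  obtain ⟨c, hc, hcp⟩ : ∃ c, G.Adj l₂ c ∧ c ≠ p := by
    simpa using exists_adj_notMem (G := G) (v := l₂) (s := {p}) (by simp [hG l₂])
  have hac : ¬ (collinearityGraph G).Adj a c := fun hac =>
    h (hcollinear h₁ h₂ h₃ h₂₁.symm h₁₃ h₂₃ ha hap' hc.symm hcp hb hpb'.symm hac)
  have hbc : ¬ (collinearityGraph G).Adj b c := fun hbc =>
    h (hcollinear h₃ h₂ h₁ h₂₃.symm h₁₃.symm h₂₁ hb hpb'.symm hc.symm hcp ha hap' hbc).symm
  obtain hab | hac' | hbc' := hC hap.symm hpb (collinearityGraph_adj hcp.symm h₂ hc.symm) hab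
    (h4.ne_of_adj_of_adj h₁ h₂ h₂₁.symm ha hap' hc.symm)
    (h4.ne_of_adj_of_adj h₃ h₂ h₂₃.symm hb hpb'.symm hc.symm)
  · exact h hab
  · exact hac hac'
  · exact hbc hbc'

variable [DecidableEq V]

theorem FourCycleFree.isRegularOfDegree_collinearityGraph (h4 : FourCycleFree G) {d : ℕ}
    (hG : G.IsRegularOfDegree (d + 1)) : (collinearityGraph G).IsRegularOfDegree ((d + 1) * d) := by
  intro v
  have hdegree (H : SimpleGraph V) [DecidableRel H.Adj] :
      H.adjMatrix ℤ *ᵥ 1 = fun v => (H.degree v : ℤ) := by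
    ext v
    simp [adjMatrix_mulVec_apply]
  have hA : G.adjMatrix ℤ *ᵥ 1 = ((d : ℤ) + 1) • 1 := by
    ext v
    simp [hG v]
  have hsum := congrFun (congrArg (· *ᵥ (1 : V → ℤ)) (h4.adjMatrix_sq_sub_one (R := ℤ))) v
  simp only [sub_mulVec, sq, ← mulVec_mulVec, hA, mulVec_smul, add_mulVec, hdegree, hG _] at hsum
  simp only [zsmul_eq_mul, Int.cast_add, Int.cast_natCast, Int.cast_one, mul_one, smul_add,
    one_mulVec, Pi.sub_apply, Pi.add_apply, Pi.mul_apply, Pi.natCast_apply, Pi.one_apply,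
    Nat.cast_add, Nat.cast_one, add_sub_cancel_right, diagonal_const_mulVec] at hsum
  zify
  linarith

theorem FourCycleFree.posDef_two_add_collinearityGraph (h4 : FourCycleFree G)
    (hG : G.IsRegularOfDegree 3) (hP : (G.adjMatrix ℝ ^ 2 - 1).PosDef) :
    (2 + (collinearityGraph G).adjMatrix ℝ).PosDef := by
  have hdiag : diagonal (fun v => (G.degree v - 1 : ℝ)) = 2 := by
    simp only [hG _]
    norm_num
    rfl
  rwa [h4.adjMatrix_sq_sub_one, hdiag] at hP

end ClusterGraph

section Labelling

open SimpleGraph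

variable {V : Type*} {G : SimpleGraph V}

theorem exists_transversal (h4 : FourCycleFree G) (hK : IsClusterGraph (collinearityGraph G))
    {p l m n a b : V} (hl : G.Adj p l) (hm : G.Adj p m) (hn : G.Adj p n) (hlm : l ≠ m)
    (hln : l ≠ n) (hmn : m ≠ n) (ha : G.Adj a l) (hap : a ≠ p) (hb : G.Adj b m) (hbp : b ≠ p) :
    ∃ k c, G.Adj a k ∧ G.Adj b k ∧ G.Adj c k ∧ G.Adj c n ∧ c ≠ p := by
  obtain ⟨-, k, hak, hbk⟩ := hK (collinearityGraph_adj hap ha hl)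
    (collinearityGraph_adj hbp.symm hm hb) (h4.ne_of_adj_of_adj hl hm hlm ha hap hb)
  have hkn : k ≠ n := by
    rintro rfl
    exact hln (h4 hap ha hl hak hn)
  obtain ⟨c, hck, hcn⟩ : ∃ c, G.Adj c k ∧ G.Adj c n := by
    obtain rfl | hkm := eq_or_ne k m
    · exact absurd (h4 hap ha hl hak hm) hlm
    · obtain ⟨-, c, hkc, hnc⟩ := hK (collinearityGraph_adj hkm hbk.symm hb.symm)
        (collinearityGraph_adj hmn hm.symm hn.symm) hkn
      exact ⟨c, hkc.symm, hnc.symm⟩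
  refine ⟨k, c, hak, hbk, hck, hcn, ?_⟩
  rintro rfl
  obtain rfl := h4 hap ha hl hak hck
  exact hlm (h4 hbp hbk hck hb hm)

theorem FourCycleFree.ne_of_transversals (h4 : FourCycleFree G) {p l m n a b b' c c' k k' : V}
    (hl : G.Adj p l) (hm : G.Adj p m) (hn : G.Adj p n) (hlm : l ≠ m) (hln : l ≠ n)
    (ha : G.Adj a l) (hap : a ≠ p) (hb : G.Adj b m) (hb' : G.Adj b' m) (hbb : b ≠ b')
    (hc : G.Adj c n) (hak : G.Adj a k) (hbk : G.Adj b k) (hck : G.Adj c k) (hak' : G.Adj a k')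
    (hbk' : G.Adj b' k') (hck' : G.Adj c' k') : c ≠ c' := by
  rintro rfl
  obtain rfl := h4 (h4.ne_of_adj_of_adj hl hn hln ha hap hc) hak hck hak' hck'
  obtain rfl := h4 hbb hbk hbk' hb hb'
  exact hlm (h4 hap ha hl hak hm)

theorem heawoodGraph_neighborSet_inl (i : ZMod 7) :
    heawoodGraph.neighborSet (Sum.inl i) = {Sum.inr i, Sum.inr (i - 1), Sum.inr (i - 3)} := by
  ext (k | k)
  · simp [heawoodGraph]
  · simp only [heawoodGraph, mem_neighborSet, Set.mem_insert_iff, Set.mem_singleton_iff,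
      Sum.inr.injEq]
    revert i k
    decide

theorem heawoodGraph_neighborSet_inr (j : ZMod 7) :
    heawoodGraph.neighborSet (Sum.inr j) = {Sum.inl j, Sum.inl (j + 1), Sum.inl (j + 3)} := by
  ext (k | k) <;> simp [heawoodGraph]

/-- The map out of the Heawood graph that sends the point `i` to `f i` and the line `j` to `g j`. -/
def heawoodHom {f g : ZMod 7 → V}
    (h : ∀ j, G.Adj (f j) (g j) ∧ G.Adj (f (j + 1)) (g j) ∧ G.Adj (f (j + 3)) (g j)) :
    heawoodGraph →g G where
  toFun := Sum.elim f g
  map_rel' {a b} hab := by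
    have hfg {i j} (hij : i = j ∨ i = j + 1 ∨ i = j + 3) : G.Adj (f i) (g j) := by
      obtain rfl | rfl | rfl := hij
      exacts [(h _).1, (h _).2.1, (h _).2.2]
    match a, b, hab with
    | .inl _, .inr _, hab => exact hfg hab
    | .inr _, .inl _, hab => exact (hfg hab).symm

theorem injOn_triple {α β : Type*} {f : α → β} {a b c : α} (hab : f a ≠ f b) (hac : f a ≠ f c)
    (hbc : f b ≠ f c) : Set.InjOn f {a, b, c} := by
  simp [Set.InjOn, hab, hbc, hac, hab.symm, hbc.symm, hac.symm]

variable [Fintype V] [DecidableRel G.Adj]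

theorem exists_two_adj_ne (hG : G.IsRegularOfDegree 3) (p l : V) :
    ∃ a b, G.Adj a l ∧ G.Adj b l ∧ a ≠ p ∧ b ≠ p ∧ a ≠ b := by
  classical
  obtain ⟨a, ha, hap⟩ : ∃ a, G.Adj l a ∧ a ≠ p := by
    simpa using exists_adj_notMem (G := G) (v := l) (s := {p}) (by simp [hG l])
  obtain ⟨b, hb, hbn⟩ := exists_adj_notMem (G := G) (v := l) (s := {p, a})
    (Finset.card_le_two.trans_lt (by simp [hG l]))
  obtain ⟨hbp, hba⟩ : b ≠ p ∧ b ≠ a := by simpa using hbn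
  exact ⟨a, b, ha.symm, hb.symm, hap, hbp, hba.symm⟩

theorem exists_three_adj (hG : G.IsRegularOfDegree 3) (p : V) :
    ∃ l m n, G.Adj p l ∧ G.Adj p m ∧ G.Adj p n ∧ l ≠ m ∧ l ≠ n ∧ m ≠ n := by
  classical
  obtain ⟨l, m, n, hlm, hln, hmn, hs⟩ := Finset.card_eq_three.1 (hG p)
  have hmem (w : V) : G.Adj p w ↔ w ∈ ({l, m, n} : Finset V) := by
    rw [← hs, mem_neighborFinset]
  exact ⟨l, m, n, by simp [hmem], by simp [hmem], by simp [hmem], hlm, hln, hmn⟩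

theorem eq_or_eq_of_adj_of_ne (hG : G.IsRegularOfDegree 3) {p l a b q : V} (hp : G.Adj p l)
    (ha : G.Adj a l) (hb : G.Adj b l) (hap : a ≠ p) (hbp : b ≠ p) (hab : a ≠ b) (hq : G.Adj q l)
    (hqp : q ≠ p) : q = a ∨ q = b := by
  classical
  have hmem : q ∈ ({p, a, b} : Finset V) := mem_of_adj_of_degree_le_card
    (by simp [hp.symm, ha.symm, hb.symm]) (by simp [hG l, hap.symm, hbp.symm, hab]) hq.symm
  simpa [hqp] using hmem

theorem exists_heawoodGraph_hom (h4 : FourCycleFree G) (hG : G.IsRegularOfDegree 3)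
    (hK : IsClusterGraph (collinearityGraph G)) (p : V) :
    ∃ φ : heawoodGraph →g G, φ (Sum.inl 1) = p ∧
      Set.InjOn φ (heawoodGraph.neighborSet (Sum.inl 1)) ∧
      ∀ l ∈ heawoodGraph.neighborSet (Sum.inl 1), Set.InjOn φ (heawoodGraph.neighborSet l) := by
  obtain ⟨g₀, g₁, g₅, hg₀, hg₁, hg₅, h₀₁, h₀₅, h₁₅⟩ := exists_three_adj hG p
  obtain ⟨x₀, x₃, hx₀, hx₃, hx₀p, hx₃p, hx₀₃⟩ := exists_two_adj_ne hG p g₀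
  obtain ⟨x₂, x₄, hx₂, hx₄, hx₂p, hx₄p, hx₂₄⟩ := exists_two_adj_ne hG p g₁
  have transversal {a b} (ha : G.Adj a g₀) (hap : a ≠ p) (hb : G.Adj b g₁) (hbp : b ≠ p) :=
    exists_transversal h4 hK hg₀ hg₁ hg₅ h₀₁ h₀₅ h₁₅ ha hap hb hbp
  obtain ⟨g₂, x₅, h₃₂, h₂₂, h₅₂, hx₅, hx₅p⟩ := transversal hx₃ hx₃p hx₂ hx₂p
  obtain ⟨g₆, x₆, h₀₆, h₂₆, h₆₆, hx₆, hx₆p⟩ := transversal hx₀ hx₀p hx₂ hx₂p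
  obtain ⟨g₄, y, h₀₄, h₄₄, h₅₄, hy, hyp⟩ := transversal hx₀ hx₀p hx₄ hx₄p
  obtain ⟨g₃, z, h₃₃, h₄₃, h₆₃, hz, hzp⟩ := transversal hx₃ hx₃p hx₄ hx₄p
  have hx₅₆ : x₅ ≠ x₆ := h4.ne_of_transversals hg₁ hg₀ hg₅ h₀₁.symm h₁₅ hx₂ hx₂p hx₃ hx₀
    hx₀₃.symm hx₅ h₂₂ h₃₂ h₅₂ h₂₆ h₀₆ h₆₆
  have hg₅_points {q} (hq : G.Adj q g₅) (hqp : q ≠ p) : q = x₅ ∨ q = x₆ :=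
    eq_or_eq_of_adj_of_ne hG hg₅ hx₅ hx₆ hx₅p hx₆p hx₅₆ hq hqp
  obtain rfl : y = x₅ := (hg₅_points hy hyp).resolve_right (h4.ne_of_transversals hg₀ hg₁ hg₅
    h₀₁ h₀₅ hx₀ hx₀p hx₄ hx₂ hx₂₄.symm hy h₀₄ h₄₄ h₅₄ h₀₆ h₂₆ h₆₆)
  obtain rfl : z = x₆ := (hg₅_points hz hzp).resolve_left (h4.ne_of_transversals hg₀ hg₁ hg₅
    h₀₁ h₀₅ hx₃ hx₃p hx₄ hx₂ hx₂₄.symm hz h₃₃ h₄₃ h₆₃ h₃₂ h₂₂ h₅₂)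
  refine ⟨heawoodHom (f := (![x₀, p, x₂, x₃, x₄, y, z] : Fin 7 → V))
    (g := (![g₀, g₁, g₂, g₃, g₄, g₅, g₆] : Fin 7 → V)) ?_, rfl, ?_, ?_⟩
  · intro j
    change Fin 7 at j
    fin_cases j
    exacts [⟨hx₀, hg₀, hx₃⟩, ⟨hg₁, hx₂, hx₄⟩, ⟨h₂₂, h₃₂, h₅₂⟩, ⟨h₃₃, h₄₃, h₆₃⟩, ⟨h₄₄, h₅₄, h₀₄⟩,
      ⟨hx₅, hx₆, hg₅⟩, ⟨h₆₆, h₀₆, h₂₆⟩]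
  · rw [heawoodGraph_neighborSet_inl]
    exact injOn_triple h₀₁.symm h₁₅ h₀₅
  · rw [heawoodGraph_neighborSet_inl]
    rintro _ (rfl | rfl | rfl) <;> rw [heawoodGraph_neighborSet_inr]
    · exact injOn_triple hx₂p.symm hx₄p.symm hx₂₄
    · exact injOn_triple hx₀p hx₀₃ hx₃p.symm
    · exact injOn_triple hx₅₆ hx₅p hx₆p

end Labelling

section HeawoodComponents

open SimpleGraph Matrix

instance : DecidableRel heawoodGraph.Adj
  | .inl p, .inr j => inferInstanceAs (Decidable (p = j ∨ p = j + 1 ∨ p = j + 3))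
  | .inr j, .inl p => inferInstanceAs (Decidable (p = j ∨ p = j + 1 ∨ p = j + 3))
  | .inl _, .inl _ | .inr _, .inr _ => inferInstanceAs (Decidable False)

theorem isRegularOfDegree_heawoodGraph : heawoodGraph.IsRegularOfDegree 3 := by
  unfold IsRegularOfDegree
  decide

theorem exists_line_through (i k : ZMod 7) :
    ∃ j, heawoodGraph.Adj (Sum.inl i) (Sum.inr j) ∧ heawoodGraph.Adj (Sum.inl k) (Sum.inr j) := by
  revert i k
  decide

theorem three_lt_card_points_of_ne {j k : ZMod 7} (h : j ≠ k) :
    3 < Finset.card {i | heawoodGraph.Adj (Sum.inr j) (Sum.inl i) ∨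
      heawoodGraph.Adj (Sum.inr k) (Sum.inl i)} := by
  revert j k
  decide

theorem preconnected_heawoodGraph : heawoodGraph.Preconnected := by
  have hpoints (i k : ZMod 7) : heawoodGraph.Reachable (Sum.inl i) (Sum.inl k) := by
    obtain ⟨j, hi, hk⟩ := exists_line_through i k
    exact hi.reachable.trans hk.symm.reachable
  have hpoint : ∀ w, ∃ i, heawoodGraph.Reachable w (Sum.inl i)
    | .inl i => ⟨i, Reachable.rfl⟩
    | .inr j => ⟨j, Adj.reachable (Or.inl rfl)⟩
  intro v w
  obtain ⟨i, hi⟩ := hpoint v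
  obtain ⟨k, hk⟩ := hpoint w
  exact hi.trans ((hpoints i k).trans hk.symm)

variable {V : Type*} {G : SimpleGraph V} {φ : heawoodGraph →g G}

theorem FourCycleFree.injective_points (h4 : FourCycleFree G) {i : ZMod 7}
    (hlines : Set.InjOn φ (heawoodGraph.neighborSet (Sum.inl i)))
    (hpoints : ∀ l ∈ heawoodGraph.neighborSet (Sum.inl i),
      Set.InjOn φ (heawoodGraph.neighborSet l)) :
    Function.Injective fun k => φ (Sum.inl k) := by
  intro a b (hab : φ (Sum.inl a) = φ (Sum.inl b))
  obtain ⟨l, hil, hal⟩ := exists_line_through i a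
  obtain ⟨m, him, hbm⟩ := exists_line_through i b
  obtain rfl | hlm := eq_or_ne l m
  · exact Sum.inl_injective (hpoints (Sum.inr l) hil hal.symm hbm.symm hab)
  have hline : φ (Sum.inr l) ≠ φ (Sum.inr m) := fun h => hlm (Sum.inr_injective (hlines hil him h))
  -- The images of the two lines share both `φ i` and `φ a = φ b`.
  have hia : φ (Sum.inl a) = φ (Sum.inl i) := by
    by_contra hne
    refine hline (h4 hne (φ.map_adj hal) (φ.map_adj hil) ?_ (φ.map_adj him))
    exact hab ▸ φ.map_adj hbm
  have ha := hpoints (Sum.inr l) hil hal.symm hil.symm hia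
  have hb := hpoints (Sum.inr m) him hbm.symm him.symm (hab.symm.trans hia)
  exact Sum.inl_injective (ha.trans hb.symm)

theorem injective_lines [Fintype V] [DecidableRel G.Adj] (hdeg : ∀ v, G.degree v ≤ 3)
    (hpoints : Function.Injective fun k => φ (Sum.inl k)) :
    Function.Injective fun j => φ (Sum.inr j) := by
  classical
  intro j k (hjk : φ (Sum.inr j) = φ (Sum.inr k))
  by_contra hne
  let s : Finset (ZMod 7) := {i | heawoodGraph.Adj (Sum.inr j) (Sum.inl i) ∨
    heawoodGraph.Adj (Sum.inr k) (Sum.inl i)}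
  have hcard : 3 < s.card := three_lt_card_points_of_ne hne
  have hsub : s.image (fun i => φ (Sum.inl i)) ⊆ G.neighborFinset (φ (Sum.inr j)) := by
    intro v hv
    obtain ⟨i, hi, rfl⟩ := Finset.mem_image.1 hv
    rw [mem_neighborFinset]
    obtain hi | hi := (Finset.mem_filter.1 hi).2
    · exact φ.map_adj hi
    · exact hjk ▸ φ.map_adj hi
  have hle := Finset.card_le_card hsub
  rw [Finset.card_image_of_injective _ hpoints, card_neighborFinset_eq_degree] at hle
  exact absurd (hcard.trans_le hle) (hdeg _).not_gt

theorem point_ne_line (hbip : G.IsBipartite) (i j : ZMod 7) : φ (Sum.inl i) ≠ φ (Sum.inr j) := by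
  obtain ⟨c⟩ := hbip
  obtain ⟨k, hi, hj⟩ := exists_line_through i j
  have hik := c.valid (φ.map_adj hi)
  have hjk := c.valid (φ.map_adj hj)
  have hjj := c.valid (φ.map_adj (show heawoodGraph.Adj (Sum.inl j) (Sum.inr j) from Or.inl rfl))
  intro h
  rw [h] at hik
  omega

variable [Fintype V] [DecidableRel G.Adj]

theorem FourCycleFree.nonempty_component_iso_heawoodGraph (h4 : FourCycleFree G)
    (hbip : G.IsBipartite) (hG : G.IsRegularOfDegree 3)
    (hK : IsClusterGraph (collinearityGraph G)) (C : G.ConnectedComponent) :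
    Nonempty (C.toSimpleGraph ≃g heawoodGraph) := by
  obtain ⟨p, rfl⟩ := C.exists_rep
  obtain ⟨φ, rfl, hlines, hpoints⟩ := exists_heawoodGraph_hom h4 hG hK p
  have hinl := h4.injective_points hlines hpoints
  have hinj : Function.Injective φ := by
    rintro (i | i) (j | j) hij
    · exact congrArg _ (hinl hij)
    · exact absurd hij (point_ne_line hbip i j)
    · exact absurd hij.symm (point_ne_line hbip j i)
    · exact congrArg _ (injective_lines (fun v => (hG v).le) hinl hij)
  have hcover := isGraphCovering_of_injOn_of_degree_le φ (fun _ => hinj.injOn)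
    fun w => ((hG _).trans (isRegularOfDegree_heawoodGraph w).symm).le
  exact hcover.nonempty_component_iso hinj preconnected_heawoodGraph _

theorem nonempty_component_iso_heawoodGraph_of_posDef [DecidableEq V] (hbip : G.IsBipartite)
    (hdeg : ∀ v, G.degree v ≤ 3) (hP : (G.adjMatrix ℝ ^ 2 - 1).PosDef)
    (C : G.ConnectedComponent) : Nonempty (C.toSimpleGraph ≃g heawoodGraph) := by
  have h4 := fourCycleFree_of_posDef hP hdeg
  have hG := isRegularOfDegree_three_of_posDef hP hdeg
  have hK := h4.posDef_two_add_collinearityGraph hG hP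
  have hK6 := h4.isRegularOfDegree_collinearityGraph hG
  exact h4.nonempty_component_iso_heawoodGraph hbip hG (isClusterGraph_collinearityGraph h4 hG
    (clawFree_of_posDef hK hK6 (by norm_num)) (diamondFree_of_posDef hK hK6 (by norm_num))) C

end HeawoodComponents

section HeawoodSpectrum

open SimpleGraph Matrix

theorem heawoodGraph_adjMatrix_sq_sub_two :
    heawoodGraph.adjMatrix ℝ ^ 2 - (2 : ℝ) • 1 =
      fromBlocks (of fun _ _ => 1) 0 0 (of fun _ _ => 1) := by
  have hcard : ∀ u v, (heawoodGraph.neighborFinset u ∩ heawoodGraph.neighborFinset v).card =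
      (if u = v then 2 else 0) + if u.isLeft = v.isLeft then 1 else 0 := by decide
  ext u v
  rw [sq, Matrix.sub_apply, adjMatrix_sq_apply, hcard]
  rcases u with i | i <;> rcases v with j | j <;> simp [one_apply]

theorem heawoodGraph_adjMatrix_sq_sub_two_sq :
    (heawoodGraph.adjMatrix ℝ ^ 2 - (2 : ℝ) • 1) ^ 2 =
      (7 : ℝ) • (heawoodGraph.adjMatrix ℝ ^ 2 - (2 : ℝ) • 1) := by
  rw [heawoodGraph_adjMatrix_sq_sub_two, sq, fromBlocks_multiply, fromBlocks_smul]
  congr 1 <;> ext <;> simp [mul_apply]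

theorem sq_eq_two_or_nine_of_heawoodGraph {x : ZMod 7 ⊕ ZMod 7 → ℝ} (hx : x ≠ 0) {μ : ℝ}
    (h : heawoodGraph.adjMatrix ℝ *ᵥ x = μ • x) : μ ^ 2 = 2 ∨ μ ^ 2 = 9 := by
  have hS : (heawoodGraph.adjMatrix ℝ ^ 2 - (2 : ℝ) • 1) *ᵥ x = (μ ^ 2 - 2) • x := by
    rw [sub_mulVec, sq, ← mulVec_mulVec, h, mulVec_smul, h, smul_mulVec, one_mulVec, smul_smul,
      ← sq, sub_smul]
  have hSS := congrArg (· *ᵥ x) heawoodGraph_adjMatrix_sq_sub_two_sq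
  simp only [sq (_ - _), ← mulVec_mulVec, smul_mulVec, hS, mulVec_smul, smul_smul] at hSS
  have hμ := smul_left_injective ℝ hx hSS
  obtain h2 | h9 : μ ^ 2 - 2 = 0 ∨ μ ^ 2 - 9 = 0 := by
    rw [← mul_eq_zero]
    linear_combination hμ
  · exact Or.inl (sub_eq_zero.1 h2)
  · exact Or.inr (sub_eq_zero.1 h9)

variable {V : Type*} [Fintype V] {G : SimpleGraph V} [DecidableRel G.Adj]

theorem sq_eq_two_or_nine_of_component_iso
    (h : ∀ C : G.ConnectedComponent, Nonempty (C.toSimpleGraph ≃g heawoodGraph)) {x : V → ℝ}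
    (hx : x ≠ 0) {μ : ℝ} (hμ : G.adjMatrix ℝ *ᵥ x = μ • x) : μ ^ 2 = 2 ∨ μ ^ 2 = 9 := by
  obtain ⟨v, hv⟩ := Function.ne_iff.1 hx
  obtain ⟨e⟩ := h (G.connectedComponentMk v)
  refine sq_eq_two_or_nine_of_heawoodGraph (x := x ∘ fun w => e.symm w) (fun hzero => hv ?_) ?_
  · simpa using congrFun hzero (e ⟨v, rfl⟩)
  · rw [(isGraphCovering_of_component_iso e).adjMatrix_mulVec_comp, hμ]
    rfl

variable [DecidableEq V] [Nonempty V]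

theorem medianH_sq_le_degree (hbip : G.IsBipartite) (v : V) : G.medianH ^ 2 ≤ G.degree v := by
  refine (Real.le_sqrt (medianH_nonneg hbip) (Nat.cast_nonneg _)).1 ?_
  by_contra! h
  have hpos := (posDef_adjMatrix_sq_sub_of_lt_medianH hbip (Real.sqrt_nonneg _) h).diag_pos (i := v)
  rw [Matrix.sub_apply, sq, adjMatrix_mul_self_apply_self, Matrix.smul_apply, one_apply_eq,
    Real.sq_sqrt (Nat.cast_nonneg _)] at hpos
  simp at hpos

theorem medianH_eq_sqrt_two (hbip : G.IsBipartite) (hdeg : ∀ v, G.degree v ≤ 3)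
    (h : ∀ C : G.ConnectedComponent, Nonempty (C.toSimpleGraph ≃g heawoodGraph)) :
    G.medianH = √2 := by
  have hA := G.isHermitian_adjMatrix (R := ℝ)
  obtain ⟨i, hi⟩ := exists_eigenvalues_eq_medianH (G := G)
  have hx : ⇑(hA.eigenvectorBasis i) ≠ 0 := fun hzero =>
    hA.eigenvectorBasis.orthonormal.ne_zero i (by ext v; exact congrFun hzero v)
  have h0 := medianH_nonneg hbip
  obtain ⟨v⟩ := ‹Nonempty V›
  have h3 : G.medianH ^ 2 ≤ 3 := (medianH_sq_le_degree hbip v).trans (mod_cast hdeg v)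
  obtain hsq | hsq := sq_eq_two_or_nine_of_component_iso h hx
    ((hA.mulVec_eigenvectorBasis i).trans (by rw [hi]))
  · rw [← hsq, Real.sqrt_sq h0]
  · linarith

theorem medianH_le_one (hbip : G.IsBipartite) (hdeg : ∀ v, G.degree v ≤ 3)
    (h : ¬ ∀ C : G.ConnectedComponent, Nonempty (C.toSimpleGraph ≃g heawoodGraph)) :
    G.medianH ≤ 1 := by
  by_contra! hlt
  refine h (nonempty_component_iso_heawoodGraph_of_posDef hbip hdeg ?_)
  simpa using posDef_adjMatrix_sq_sub_of_lt_medianH hbip zero_le_one hlt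

end HeawoodSpectrum

theorem theorem2 {V : Type*} [Fintype V] [DecidableEq V] [Nonempty V]
    (G : SimpleGraph V) [DecidableRel G.Adj]
    (hbip : G.IsBipartite) (hdeg : G.maxDegree ≤ 3) :
    ((∀ C : G.ConnectedComponent, Nonempty (C.toSimpleGraph ≃g heawoodGraph)) →
      G.hlIndex = √2 ∧ G.medianH = √2 ∧ |G.medianL| = √2) ∧
    ((¬ ∀ C : G.ConnectedComponent, Nonempty (C.toSimpleGraph ≃g heawoodGraph)) →
      G.medianH ∈ Set.Icc (-1 : ℝ) 1 ∧ G.medianL ∈ Set.Icc (-1 : ℝ) 1 ∧ G.hlIndex ≤ 1) := by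
  have hdeg' (v : V) : G.degree v ≤ 3 := (G.degree_le_maxDegree v).trans hdeg
  have h0 := medianH_nonneg hbip
  rw [hlIndex_eq_medianH hbip, medianL_eq_neg_medianH hbip, abs_neg, abs_of_nonneg h0]
  refine ⟨fun h => ?_, fun h => ?_⟩
  · have hH := medianH_eq_sqrt_two hbip hdeg' h
    exact ⟨hH, hH, hH⟩
  · have hH := medianH_le_one hbip hdeg' h
    exact ⟨⟨by linarith, hH⟩, ⟨by linarith, by linarith⟩, hH⟩
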